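/- Graphs are finite and may have loops and parallel edges; an edge consists of two distinct half-edges, each incident on one vertex, and an edge is directed by calling one of its half-edges initial. Let $F$ be a 4-regular graph (every vertex is incident on exactly four half-edges). A \emph{circuit} is a closed trail using at least one edge and no half-edge more than once (vertices may be repeated), considered up to orientation and starting point. A \emph{circuit partition} $P$ of $F$ is a partition of $E(F)$ into edge-disjoint circuits, and an \emph{Euler system} of $F$ is a set containing precisely one Euler circuit of each connected component of $F$ (and nothing else). For a circuit partition $P$, a \emph{single transition} of $P$ is a pair $\{h,h'\}$ of half-edges at a vertex that are consecutive on a circuit of $P$; there are two of them at each vertex. The touch-graph $Tch(P)$ has a vertex $v_\gamma$ for each $\gamma\in P$ and an edge $e_v$ for each $v\in V(F)$; the two half-edges of $e_v$ are the two single transitions of $P$ at $v$, each incident on $v_\gamma$ where $\gamma$ is the circuit of $P$ that includes it. For a half-edge $h$ of $F$ let $\overline h$ be the half-edge of $Tch(P)$ given by the single transition of $P$ containing $h$. A closed walk $W$ in $F$ has a shadow $\overline W$ in $Tch(P)$: each time $W$ passes through a vertex $v$, arriving by $h$ and leaving by $h'$, nothing is added if $\{h,h'\}$ is a single transition of $P$,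 and otherwise $\overline W$ traverses $e_v$ from $\overline h$ to $\overline{h'}$. If $D$ is a directed version of $Tch(P)$, then $z_D(\overline W)\in\mathbb R^{V(F)}$ is the vector whose $w$ coordinate is the number of times $\overline W$ traverses $e_w$ in accordance with $D$ minus the number of times it traverses $e_w$ against $D$. Let $C$ be an Euler system of $F$. For each $v\in V(F)$ the circuit of $C$ through $v$ is divided into two circuits, each leading from $v$ to $v$; these are the \emph{fundamental circuits} of $C$ at $v$. Let $E$ be a set of edges that contains precisely one edge from each connected component of $F$. A \emph{set of oriented fundamental circuits of $C$ based at $E$}, denoted $\Gamma_E=\{C_{\Gamma_E}(v)\mid v\in V(F)\}$, consists of one fundamental circuit $C_{\Gamma_E}(v)$ of $C$ at each $v\in V(F)$, with an arbitrary orientation, such that no $C_{\Gamma_E}(v)$ includes an element of $E$. For a circuit partition $P$ and a directed version $D$ of $Tch(P)$, let $M_{\mathbb R,\Gamma_E}(C,P,D)$ be the $V(F)\times V(F)$ matrix whose $v$ row is $z_D(\overline{C_{\Gamma_E}(v)})$. Theorem. Let $C$ be an Euler system of a 4-regular graph $F$, and let $\Gamma_E$ be a based set of oriented fundamental circuits of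 $C$. Then \[ \det M_{\mathbb R,\Gamma_E}(C,P,D)\in\{-1,0,1\} \] for every circuit partition $P$ of $F$ and every directed version $D$ of $Tch(P)$. -/

import Mathlib

/-- A graph, possibly with loops and parallel edges: every half-edge is incident on one vertex and
belongs to one edge, and every edge consists of two distinct half-edges. -/
structure HalfEdgeGraph (V E H : Type*) where
  inc : H → V
  edge : H → E
  two_halves : ∀ e : E, {h : H | edge h = e}.ncard = 2

namespace HalfEdgeGraph

variable {V E H : Type*}

/-- `F` is 4-regular: every vertex is incident on exactly four half-edges. -/
def IsFourRegular (F : HalfEdgeGraph V E H) : Prop :=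
  ∀ v : V, {h : H | F.inc h = v}.ncard = 4

theorem exists_opp (F : HalfEdgeGraph V E H) (h : H) :
    ∃ h' : H, h' ≠ h ∧ ∀ k : H, F.edge k = F.edge h ↔ k = h ∨ k = h' := by
  obtain ⟨a, b, hab, hs⟩ := Set.ncard_eq_two.mp (F.two_halves (F.edge h))
  have key : ∀ k : H, F.edge k = F.edge h ↔ k = a ∨ k = b := fun k => by
    have : k ∈ {k : H | F.edge k = F.edge h} ↔ k ∈ ({a, b} : Set H) := by rw [hs]
    simpa using this
  rcases (key h).mp rfl with rfl | rfl
  · exact ⟨b, hab.symm, key⟩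
  · exact ⟨a, hab, fun k => (key k).trans or_comm⟩

/-- The other half-edge of the edge that contains `h`. -/
noncomputable def opp (F : HalfEdgeGraph V E H) (h : H) : H :=
  Classical.choose (F.exists_opp h)

theorem opp_ne (F : HalfEdgeGraph V E H) (h : H) : F.opp h ≠ h :=
  (Classical.choose_spec (F.exists_opp h)).1

theorem edge_eq_iff (F : HalfEdgeGraph V E H) (k h : H) :
    F.edge k = F.edge h ↔ k = h ∨ k = F.opp h :=
  (Classical.choose_spec (F.exists_opp h)).2 k

theorem edge_opp (F : HalfEdgeGraph V E H) (h : H) : F.edge (F.opp h) = F.edge h :=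
  (F.edge_eq_iff _ _).mpr (Or.inr rfl)

theorem opp_opp (F : HalfEdgeGraph V E H) (h : H) : F.opp (F.opp h) = h := by
  rcases (F.edge_eq_iff h (F.opp h)).mp (F.edge_opp h).symm with e | e
  · exact absurd e.symm (F.opp_ne h)
  · exact e.symm

/-- The simple graph with the same adjacency between distinct vertices, used only to speak of
connected components. -/
def toSimpleGraph (F : HalfEdgeGraph V E H) : SimpleGraph V :=
  SimpleGraph.fromRel fun v w => ∃ h : H, F.inc h = v ∧ F.inc (F.opp h) = w

/-- The connected component of `F` that contains the half-edge `h`. -/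
def component (F : HalfEdgeGraph V E H) (h : H) : F.toSimpleGraph.ConnectedComponent :=
  F.toSimpleGraph.connectedComponentMk (F.inc h)

/-- Following the half-edges `h'₁, …, h'ₙ` of the list outwards and around cyclically, these are
the passages through vertices: pairs `(h, h')` where `h` is the half-edge by which we arrive at a
vertex, and `h'` is the half-edge by which we leave it. -/
noncomputable def passages (F : HalfEdgeGraph V E H) (l : List H) : List (H × H) :=
  (l.map F.opp).zip (l.rotate 1)

/-- An oriented closed trail with a starting point, given by the list of the half-edges by which it
leaves its vertices.  It does not visit a half-edge more than once, but it may visit a vertex more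
than once. -/
structure ClosedTrail (F : HalfEdgeGraph V E H) where
  darts : List H
  ne_nil : darts ≠ []
  inc_eq : ∀ p ∈ F.passages darts, F.inc p.1 = F.inc p.2
  nodup : (darts ++ darts.map F.opp).Nodup

/-- The vertex at which a closed trail starts. -/
def ClosedTrail.start {F : HalfEdgeGraph V E H} (t : ClosedTrail F) : V :=
  F.inc (t.darts.head t.ne_nil)

/-- The list of half-edges by which we leave the vertices on the reversed walk. -/
noncomputable def reverseDarts (F : HalfEdgeGraph V E H) (l : List H) : List H :=
  (l.map F.opp).reverse

theorem reverseDarts_reverseDarts (F : HalfEdgeGraph V E H) (l : List H) :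
    F.reverseDarts (F.reverseDarts l) = l := by
  simp [reverseDarts, Function.comp_def, opp_opp]

theorem isRotated_reverseDarts (F : HalfEdgeGraph V E H) {l l' : List H} (h : l ~r l') :
    F.reverseDarts l ~r F.reverseDarts l' :=
  (h.map F.opp).reverse

/-- Closed trails are identified if they differ only in orientation or starting point. -/
instance circuitSetoid (F : HalfEdgeGraph V E H) : Setoid (ClosedTrail F) where
  r t t' := t.darts ~r t'.darts ∨ t.darts ~r F.reverseDarts t'.darts
  iseqv :=
    { refl := fun t => Or.inl (List.IsRotated.refl _)
      symm := by
        rintro t t' (h | h)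
        · exact Or.inl h.symm
        · right
          have := F.isRotated_reverseDarts h.symm
          rwa [reverseDarts_reverseDarts] at this
      trans := by
        rintro t t' t'' (h | h) (h' | h')
        · exact Or.inl (h.trans h')
        · exact Or.inr (h.trans h')
        · exact Or.inr (h.trans (F.isRotated_reverseDarts h'))
        · left
          have := F.isRotated_reverseDarts h'
          rw [reverseDarts_reverseDarts] at this
          exact h.trans this }

/-- A circuit: a closed trail up to orientation and starting point. -/
def Circuit (F : HalfEdgeGraph V E H) : Type _ := Quotient F.circuitSetoid

/-- The circuit of a closed trail. -/
def ClosedTrail.circuit {F : HalfEdgeGraph V E H} (t : ClosedTrail F) : Circuit F :=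
  Quotient.mk F.circuitSetoid t

/-- The set of edges that a circuit includes. -/
def Circuit.edges {F : HalfEdgeGraph V E H} (γ : Circuit F) : Set E :=
  {e | ∃ t : ClosedTrail F, t.circuit = γ ∧ ∃ d ∈ t.darts, F.edge d = e}

/-- An Euler system: a set of circuits that contains precisely one Euler circuit of each connected
component, and nothing else. -/
structure EulerSystem (F : HalfEdgeGraph V E H) where
  circuits : Set (Circuit F)
  euler : ∀ γ ∈ circuits, ∃ c : F.toSimpleGraph.ConnectedComponent,
    ∀ h : H, F.edge h ∈ γ.edges ↔ F.component h = c
  unique : ∀ c : F.toSimpleGraph.ConnectedComponent, ∃! γ : Circuit F,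
    γ ∈ circuits ∧ ∀ h : H, F.edge h ∈ γ.edges ↔ F.component h = c

/-- A circuit partition: a partition of the edge set into edge-disjoint circuits. -/
structure CircuitPartition (F : HalfEdgeGraph V E H) where
  circuits : Set (Circuit F)
  partition : ∀ e : E, ∃! γ : Circuit F, γ ∈ circuits ∧ e ∈ γ.edges

/-- `t` is an oriented fundamental circuit of `C` at `v`, written with starting point `v`: some
circuit of `C` consists of `t`, leading from `v` to `v`, followed by another closed trail from `v`
to `v`. -/
def EulerSystem.IsFundamental {F : HalfEdgeGraph V E H} (C : EulerSystem F) (v : V)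
    (t : ClosedTrail F) : Prop :=
  t.start = v ∧ ∃ s c : ClosedTrail F,
    s.start = v ∧ c.darts = t.darts ++ s.darts ∧ c.circuit ∈ C.circuits

/-- A choice of one oriented fundamental circuit of `C` at each vertex. -/
structure FundamentalCircuits {F : HalfEdgeGraph V E H} (C : EulerSystem F) where
  at_ : V → ClosedTrail F
  fundamental : ∀ v : V, C.IsFundamental v (at_ v)

/-- `B` contains precisely one edge from each connected component of `F`. -/
def IsBaseSet (F : HalfEdgeGraph V E H) (B : Set E) : Prop :=
  ∀ c : F.toSimpleGraph.ConnectedComponent, ∃! e : E,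
    e ∈ B ∧ ∃ h : H, F.edge h = e ∧ F.component h = c

/-- The chosen fundamental circuits are based at `B`: they exclude every element of `B`, a set of
edges with one edge from each connected component. -/
def FundamentalCircuits.IsBasedAt {F : HalfEdgeGraph V E H} {C : EulerSystem F}
    (Γ : FundamentalCircuits C) (B : Set E) : Prop :=
  F.IsBaseSet B ∧ ∀ v : V, ∀ e ∈ B, e ∉ (Γ.at_ v).circuit.edges

/-! ### Single transitions of a circuit partition -/

/-- `h` and `h'` appear consecutively, around a vertex, on the closed walk `l`. -/
def Consecutive (F : HalfEdgeGraph V E H) (l : List H) (h h' : H) : Prop :=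
  (h, h') ∈ F.passages l ∨ (h', h) ∈ F.passages l

/-- `{h, h'}` is one of the single transitions of the circuit partition `P`. -/
def CircuitPartition.SingleTransition {F : HalfEdgeGraph V E H} (P : CircuitPartition F)
    (h h' : H) : Prop :=
  ∃ t : ClosedTrail F, t.circuit ∈ P.circuits ∧ F.Consecutive t.darts h h'

theorem length_passages (F : HalfEdgeGraph V E H) (l : List H) :
    (F.passages l).length = l.length := by
  simp [passages]

theorem mem_passages (F : HalfEdgeGraph V E H) (l : List H) (h h' : H) :
    (h, h') ∈ F.passages l ↔ ∃ (i : ℕ) (hi : i < l.length),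
      F.opp l[i] = h ∧ l[(i + 1) % l.length]'(Nat.mod_lt _ (by omega)) = h' := by
  rw [List.mem_iff_getElem]
  constructor
  · rintro ⟨i, hi, e⟩
    refine ⟨i, by simpa [length_passages] using hi, ?_⟩
    simpa [passages, List.getElem_rotate] using e
  · rintro ⟨i, hi, e1, e2⟩
    refine ⟨i, by simpa [length_passages] using hi, ?_⟩
    simp [passages, List.getElem_rotate, e1, e2]

theorem passages_rotate (F : HalfEdgeGraph V E H) (l : List H) (n : ℕ) :
    F.passages (l.rotate n) = (F.passages l).rotate n := by
  have := List.zipWith_rotate_distrib Prod.mk (l.map F.opp) (l.rotate 1) n (by simp)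
  simp only [passages, List.zip]
  rw [this, List.map_rotate, List.rotate_rotate, List.rotate_rotate, Nat.add_comm]

theorem mem_passages_reverseDarts (F : HalfEdgeGraph V E H) (l : List H) (h h' : H)
    (hp : (h, h') ∈ F.passages l) : (h', h) ∈ F.passages (F.reverseDarts l) := by
  obtain ⟨i, hi, rfl, rfl⟩ := (F.mem_passages l h h').mp hp
  rw [mem_passages]
  have hlen : (F.reverseDarts l).length = l.length := by simp [reverseDarts]
  have hm : (i + 1) % l.length < l.length := Nat.mod_lt _ (by omega)
  refine ⟨l.length - 1 - (i + 1) % l.length, by omega, ?_, ?_⟩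
  · simp only [reverseDarts, List.getElem_reverse, List.getElem_map, opp_opp, List.length_map]
    congr 1
    omega
  · simp only [reverseDarts, List.getElem_reverse, List.getElem_map, List.length_map,
      List.length_reverse]
    congr 2
    rcases Nat.lt_or_ge (i + 1) l.length with hlt | hge
    · rw [Nat.mod_eq_of_lt hlt, Nat.mod_eq_of_lt (by omega)]
      omega
    · have hl : i + 1 = l.length := by omega
      have h1 : l.length - 1 + 1 = l.length := by omega
      rw [hl, Nat.mod_self, Nat.sub_zero, h1, Nat.mod_self]
      omega

theorem Consecutive.rotated {F : HalfEdgeGraph V E H} {l l' : List H} {h h' : H}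
    (hc : F.Consecutive l h h') (hr : l ~r l') : F.Consecutive l' h h' := by
  obtain ⟨n, rfl⟩ := hr
  simpa only [Consecutive, passages_rotate, List.mem_rotate] using hc

theorem Consecutive.reversed {F : HalfEdgeGraph V E H} {l : List H} {h h' : H}
    (hc : F.Consecutive l h h') : F.Consecutive (F.reverseDarts l) h h' :=
  hc.elim (fun x => Or.inr (F.mem_passages_reverseDarts _ _ _ x))
    (fun x => Or.inl (F.mem_passages_reverseDarts _ _ _ x))

theorem Consecutive.of_circuit_eq {F : HalfEdgeGraph V E H} {t t' : ClosedTrail F} {h h' : H}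
    (hc : F.Consecutive t.darts h h') (e : t.circuit = t'.circuit) :
    F.Consecutive t'.darts h h' := by
  rcases (Quotient.exact e : t.darts ~r t'.darts ∨ t.darts ~r F.reverseDarts t'.darts) with r | r
  · exact hc.rotated r
  · have := (hc.rotated r).reversed
    rwa [reverseDarts_reverseDarts] at this

/-- A half-edge has at most one partner on a closed trail. -/
theorem ClosedTrail.consecutive_unique {F : HalfEdgeGraph V E H} (t : ClosedTrail F)
    {h h' h'' : H} (h1 : F.Consecutive t.darts h h') (h2 : F.Consecutive t.darts h h'') :
    h' = h'' := by
  have hn := t.nodup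
  rw [List.nodup_append] at hn
  obtain ⟨hd, -, hx⟩ := hn
  have hx' : ∀ (i j : ℕ) (hi : i < t.darts.length) (hj : j < t.darts.length),
      t.darts[i] ≠ F.opp t.darts[j] := fun i j hi hj =>
    hx _ (List.getElem_mem hi) _ (List.mem_map_of_mem (List.getElem_mem hj))
  have inj : ∀ (i j : ℕ) (hi : i < t.darts.length) (hj : j < t.darts.length),
      t.darts[i] = t.darts[j] → i = j := fun i j hi hj e => (hd.getElem_inj_iff).mp e
  simp only [Consecutive, mem_passages] at h1 h2
  rcases h1 with ⟨i, hi, e1, e2⟩ | ⟨i, hi, e1, e2⟩ <;>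
    rcases h2 with ⟨j, hj, f1, f2⟩ | ⟨j, hj, f1, f2⟩
  · have : t.darts[i] = t.darts[j] := by
      rw [← F.opp_opp t.darts[i], e1, ← f1, F.opp_opp]
    obtain rfl := inj _ _ _ _ this
    rw [← e2, ← f2]
  · exact absurd (f2.trans e1.symm) (hx' _ _ _ _)
  · exact absurd (e2.trans f1.symm) (hx' _ _ _ _)
  · have := inj _ _ _ _ (e2.trans f2.symm)
    have : i = j := by
      rcases Nat.lt_or_ge (i + 1) t.darts.length with a | a <;>
        rcases Nat.lt_or_ge (j + 1) t.darts.length with b | b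
      · rw [Nat.mod_eq_of_lt a, Nat.mod_eq_of_lt b] at this
        omega
      · rw [Nat.mod_eq_of_lt a, (by omega : j + 1 = t.darts.length), Nat.mod_self] at this
        omega
      · rw [Nat.mod_eq_of_lt b, (by omega : i + 1 = t.darts.length), Nat.mod_self] at this
        omega
      · omega
    subst this
    rw [← e1, ← f1]

theorem ClosedTrail.consecutive_ne {F : HalfEdgeGraph V E H} (t : ClosedTrail F)
    {h h' : H} (hc : F.Consecutive t.darts h h') : h' ≠ h := by
  have hn := t.nodup
  rw [List.nodup_append] at hn
  obtain ⟨-, -, hx⟩ := hn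
  simp only [Consecutive, mem_passages] at hc
  rcases hc with ⟨i, hi, e1, e2⟩ | ⟨i, hi, e1, e2⟩
  · rw [← e1, ← e2]
    exact hx _ (List.getElem_mem _) _ (List.mem_map_of_mem (List.getElem_mem _))
  · rw [← e1, ← e2]
    exact (hx _ (List.getElem_mem _) _ (List.mem_map_of_mem (List.getElem_mem _))).symm

theorem ClosedTrail.consecutive_inc {F : HalfEdgeGraph V E H} (t : ClosedTrail F)
    {h h' : H} (hc : F.Consecutive t.darts h h') : F.inc h = F.inc h' :=
  hc.elim (fun x => t.inc_eq _ x) (fun x => (t.inc_eq _ x).symm)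

theorem Consecutive.symm {F : HalfEdgeGraph V E H} {l : List H} {h h' : H}
    (hc : F.Consecutive l h h') : F.Consecutive l h' h :=
  Or.symm hc

theorem ClosedTrail.edge_mem_of_consecutive {F : HalfEdgeGraph V E H} (t : ClosedTrail F)
    {h h' : H} (hc : F.Consecutive t.darts h h') : F.edge h ∈ t.circuit.edges := by
  simp only [Consecutive, mem_passages] at hc
  rcases hc with ⟨i, hi, e1, e2⟩ | ⟨i, hi, e1, e2⟩
  · exact ⟨t, rfl, _, List.getElem_mem hi, by rw [← e1, edge_opp]⟩
  · exact ⟨t, rfl, _, List.getElem_mem _, by rw [← e2]⟩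

theorem ClosedTrail.exists_consecutive {F : HalfEdgeGraph V E H} (t : ClosedTrail F)
    {h d : H} (hd : d ∈ t.darts) (he : F.edge h = F.edge d) :
    ∃ h', F.Consecutive t.darts h h' := by
  obtain ⟨i, hi, rfl⟩ := List.mem_iff_getElem.mp hd
  rcases (F.edge_eq_iff _ _).mp he with rfl | rfl
  · have : ∃ j, ∃ _ : j < t.darts.length, (j + 1) % t.darts.length = i := by
      rcases Nat.eq_zero_or_pos i with rfl | hpos
      · refine ⟨t.darts.length - 1, by omega, ?_⟩
        rw [Nat.sub_add_cancel (by omega), Nat.mod_self]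
      · refine ⟨i - 1, by omega, ?_⟩
        rw [Nat.sub_add_cancel hpos, Nat.mod_eq_of_lt hi]
    obtain ⟨j, hj, rfl⟩ := this
    exact ⟨_, Or.inr ((F.mem_passages _ _ _).mpr ⟨j, hj, rfl, rfl⟩)⟩
  · exact ⟨_, Or.inl ((F.mem_passages _ _ _).mpr ⟨i, hi, rfl, rfl⟩)⟩

namespace CircuitPartition

variable {F : HalfEdgeGraph V E H} (P : CircuitPartition F)

/-- The circuit of the partition that includes a given half-edge. -/
noncomputable def circuitOf (h : H) : Circuit F :=
  Classical.choose (P.partition (F.edge h))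

theorem circuitOf_mem (h : H) : P.circuitOf h ∈ P.circuits :=
  (Classical.choose_spec (P.partition (F.edge h))).1.1

theorem edge_mem_circuitOf (h : H) : F.edge h ∈ (P.circuitOf h).edges :=
  (Classical.choose_spec (P.partition (F.edge h))).1.2

theorem eq_circuitOf {h : H} {γ : Circuit F} (hγ : γ ∈ P.circuits) (he : F.edge h ∈ γ.edges) :
    γ = P.circuitOf h :=
  (Classical.choose_spec (P.partition (F.edge h))).2 γ ⟨hγ, he⟩

variable {P}

theorem SingleTransition.symm {h h' : H} (s : P.SingleTransition h h') :
    P.SingleTransition h' h := by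
  obtain ⟨t, ht, hc⟩ := s
  exact ⟨t, ht, hc.symm⟩

theorem SingleTransition.ne {h h' : H} (s : P.SingleTransition h h') : h' ≠ h := by
  obtain ⟨t, ht, hc⟩ := s
  exact t.consecutive_ne hc

theorem SingleTransition.inc_eq {h h' : H} (s : P.SingleTransition h h') :
    F.inc h = F.inc h' := by
  obtain ⟨t, ht, hc⟩ := s
  exact t.consecutive_inc hc

theorem SingleTransition.circuitOf_eq {h h' : H} (s : P.SingleTransition h h') :
    P.circuitOf h = P.circuitOf h' := by
  obtain ⟨t, ht, hc⟩ := s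
  rw [← P.eq_circuitOf ht (t.edge_mem_of_consecutive hc),
    ← P.eq_circuitOf ht (t.edge_mem_of_consecutive hc.symm)]

theorem SingleTransition.unique {h h' h'' : H} (s : P.SingleTransition h h')
    (s' : P.SingleTransition h h'') : h' = h'' := by
  obtain ⟨t, ht, hc⟩ := s
  obtain ⟨t', ht', hc'⟩ := s'
  have e : t'.circuit = t.circuit := by
    rw [P.eq_circuitOf ht (t.edge_mem_of_consecutive hc),
      P.eq_circuitOf ht' (t'.edge_mem_of_consecutive hc')]
  exact t.consecutive_unique hc (hc'.of_circuit_eq e)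

variable (P)

theorem exists_singleTransition (h : H) : ∃ h', P.SingleTransition h h' := by
  obtain ⟨t, ht, d, hd, he⟩ := P.edge_mem_circuitOf h
  obtain ⟨h', hc⟩ := t.exists_consecutive hd he.symm
  exact ⟨h', t, ht ▸ P.circuitOf_mem h, hc⟩

/-- Two half-edges have the same shadow if they are equal or form a single transition of `P`. -/
def shadowSetoid : Setoid H where
  r h h' := h = h' ∨ P.SingleTransition h h'
  iseqv :=
    { refl := fun _ => Or.inl rfl
      symm := fun s => s.elim (fun e => Or.inl e.symm) (fun s => Or.inr s.symm)
      trans := by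
        rintro a b c (rfl | s) (rfl | s')
        · exact Or.inl rfl
        · exact Or.inr s'
        · exact Or.inr s
        · exact Or.inl (s.symm.unique s') }

/-- The half-edges of the touch-graph: one for each single transition of `P`. -/
def ShadowHalfEdge : Type _ := Quotient P.shadowSetoid

/-- The shadow `π_P(h)` of a half-edge `h` of `F`. -/
def shadow (h : H) : P.ShadowHalfEdge := Quotient.mk P.shadowSetoid h

theorem shadow_eq_iff (h h' : H) :
    P.shadow h = P.shadow h' ↔ h = h' ∨ P.SingleTransition h h' :=
  ⟨fun e => Quotient.exact e, fun e => Quotient.sound (s := P.shadowSetoid) e⟩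

/-- The vertex of `F` at which a single transition takes place. -/
def shadowEdge : P.ShadowHalfEdge → V :=
  Quotient.lift F.inc (by
    rintro a b (rfl | s)
    · rfl
    · exact s.inc_eq)

/-- The circuit of `P` that includes a given single transition. -/
noncomputable def shadowInc : P.ShadowHalfEdge → P.circuits :=
  Quotient.lift (fun h => ⟨P.circuitOf h, P.circuitOf_mem h⟩) (by
    rintro a b (rfl | s)
    · rfl
    · exact Subtype.ext s.circuitOf_eq)

/-- At each vertex of a 4-regular graph there are two single transitions of `P`. -/
theorem two_shadows (hF : F.IsFourRegular) (v : V) :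
    {q : P.ShadowHalfEdge | P.shadowEdge q = v}.ncard = 2 := by
  have h4 := hF v
  have hfin : {h : H | F.inc h = v}.Finite := Set.finite_of_ncard_ne_zero (by omega)
  obtain ⟨a, ha⟩ : {h : H | F.inc h = v}.Nonempty := by
    rw [← Set.ncard_pos hfin]; omega
  obtain ⟨a', sa⟩ := P.exists_singleTransition a
  obtain ⟨b, hb, hb'⟩ : ∃ b ∈ {h : H | F.inc h = v}, b ∉ ({a, a'} : Set H) := by
    refine Set.exists_mem_notMem_of_ncard_lt_ncard ?_ (Set.toFinite _)
    rw [Set.ncard_pair sa.ne.symm]; omega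
  obtain ⟨b', sb⟩ := P.exists_singleTransition b
  simp only [Set.mem_insert_iff, Set.mem_singleton_iff, not_or, Set.mem_ofPred_eq] at ha hb hb'
  have ha'v : F.inc a' = v := sa.inc_eq ▸ ha
  have hb'v : F.inc b' = v := sb.inc_eq ▸ hb
  have hb'a : b' ≠ a := by rintro rfl; exact hb'.2 (sb.symm.unique sa)
  have hb'a' : b' ≠ a' := by rintro rfl; exact hb'.1 (sb.symm.unique sa.symm)
  have hall : ({a, a', b, b'} : Set H) = {h : H | F.inc h = v} := by
    apply Set.eq_of_subset_of_ncard_le _ _ hfin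
    · rintro x (rfl | rfl | rfl | rfl) <;> assumption
    · rw [h4, Set.ncard_insert_of_notMem, Set.ncard_insert_of_notMem, Set.ncard_pair sb.ne.symm]
      · simp only [Set.mem_insert_iff, Set.mem_singleton_iff, not_or]
        exact ⟨fun e => hb'.2 e.symm, hb'a'.symm⟩
      · simp only [Set.mem_insert_iff, Set.mem_singleton_iff, not_or]
        exact ⟨sa.ne.symm, fun e => hb'.1 e.symm, hb'a.symm⟩
  rw [Set.ncard_eq_two]
  refine ⟨P.shadow a, P.shadow b, ?_, ?_⟩
  · rw [Ne, shadow_eq_iff]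
    rintro (e | s)
    · exact hb'.1 e.symm
    · exact hb'.2 (s.unique sa)
  · ext q
    induction q using Quotient.inductionOn with | _ h => ?_
    change F.inc h = v ↔ P.shadow h = P.shadow a ∨ P.shadow h = P.shadow b
    have : F.inc h = v ↔ h ∈ ({a, a', b, b'} : Set H) := by rw [hall]; rfl
    rw [this, shadow_eq_iff, shadow_eq_iff]
    simp only [Set.mem_insert_iff, Set.mem_singleton_iff]
    constructor
    · rintro (rfl | rfl | rfl | rfl)
      · exact Or.inl (Or.inl rfl)
      · exact Or.inl (Or.inr sa.symm)
      · exact Or.inr (Or.inl rfl)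
      · exact Or.inr (Or.inr sb.symm)
    · rintro ((rfl | s) | (rfl | s))
      · exact Or.inl rfl
      · exact Or.inr (Or.inl (s.symm.unique sa))
      · exact Or.inr (Or.inr (Or.inl rfl))
      · exact Or.inr (Or.inr (Or.inr (s.symm.unique sb)))

/-- The touch-graph `Tch(P)`: its vertices are the circuits of `P`, its edges `e_v` are the
vertices `v` of `F`, and its half-edges are the single transitions of `P`; a single transition at
`v` that belongs to the circuit `γ` is a half-edge of `e_v` incident on `γ`. -/
noncomputable def touchGraph (hF : F.IsFourRegular) :
    HalfEdgeGraph P.circuits V P.ShadowHalfEdge where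
  inc := P.shadowInc
  edge := P.shadowEdge
  two_halves := P.two_shadows hF

open Classical in
/-- The shadow in `Tch(P)` of the closed walk `l` in `F`, as the list of the half-edges by which it
leaves the vertices of `Tch(P)`: a passage `h, v, h'` contributes nothing if `{h, h'}` is a single
transition of `P`, and otherwise it contributes `e_v`, traversed from the shadow of `h` to the
shadow of `h'`. -/
noncomputable def shadowWalk (l : List H) : List P.ShadowHalfEdge :=
  (F.passages l).filterMap fun p =>
    if P.SingleTransition p.1 p.2 then none else some (P.shadow p.1)

end CircuitPartition

/-! ### Directed versions and the matrix -/

/-- A directed version of `G`: one half-edge of every edge is distinguished as initial. -/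
structure DirectedVersion (G : HalfEdgeGraph V E H) where
  initial : E → H
  edge_initial : ∀ e : E, G.edge (initial e) = e

open Classical in
/-- The vector `z_D(W)`: tally `+1` in the `e` coordinate each time the walk `W`, given by the
half-edges by which it leaves its vertices, traverses `e` in accordance with `D`, and `-1` each time
it traverses `e` against `D`. -/
noncomputable def DirectedVersion.tally (R : Type*) [Ring R] {G : HalfEdgeGraph V E H}
    (D : DirectedVersion G) (W : List H) (e : E) : R :=
  (W.map fun h => if G.edge h = e then (if h = D.initial e then (1 : R) else -1) else 0).sum

/-- The matrix `M_{R,Γ}(C,P,D)`, whose `v` row is the vector `z_D` of the shadow in `Tch(P)` of the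
oriented fundamental circuit chosen at `v`. -/
noncomputable def shadowMatrix (R : Type*) [Ring R] {F : HalfEdgeGraph V E H}
    {hF : F.IsFourRegular} {C : EulerSystem F} (Γ : FundamentalCircuits C)
    (P : CircuitPartition F) (D : DirectedVersion (P.touchGraph hF)) : Matrix V V R :=
  Matrix.of fun v w => D.tally R (P.shadowWalk (Γ.at_ v).darts) w

end HalfEdgeGraph

namespace HalfEdgeGraph

variable {V E H : Type*} {F : HalfEdgeGraph V E H}

/-! ### Sums along walks -/

theorem sum_map_zip_sub {α A : Type*} [AddCommGroup A] (f : α → A) :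
    ∀ a b : List α, a.length = b.length →
      ((a.zip b).map fun p => f p.1 - f p.2).sum = (a.map f).sum - (b.map f).sum
  | [], [], _ => by simp
  | x :: a, y :: b, h => by
    have := sum_map_zip_sub f a b (by simpa using h)
    simp only [List.zip_cons_cons, List.map_cons, List.sum_cons, this]
    abel

theorem sum_map_sub_distrib {α A : Type*} [AddCommGroup A] (f g : α → A) (l : List α) :
    (l.map fun d => f d - g d).sum = (l.map f).sum - (l.map g).sum := by
  induction l with
  | nil => simp
  | cons a l ih => simp only [List.map_cons, List.sum_cons, ih]; abel

theorem sum_map_passages_sub {A : Type*} [AddCommGroup A] (f : H → A) (l : List H) :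
    ((F.passages l).map fun p => f p.1 - f p.2).sum = (l.map fun d => f (F.opp d) - f d).sum := by
  rw [passages, sum_map_zip_sub f _ _ (by simp), sum_map_sub_distrib,
    ((l.rotate_perm 1).map f).sum_eq, List.map_map]
  rfl

/-- The increments of a function that does not change at the vertices add up to zero around a
closed walk. -/
theorem sum_map_sub_eq_zero {A : Type*} [AddCommGroup A] {f : H → A} {l : List H}
    (hf : ∀ p ∈ F.passages l, f p.1 = f p.2) :
    (l.map fun d => f (F.opp d) - f d).sum = 0 := by
  rw [← sum_map_passages_sub, List.map_congr_left (g := fun _ => (0 : A))]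
  · simp
  · intro p hp
    rw [hf p hp, sub_self]

theorem isChain_of_passages {l : List H} {R : H → H → Prop}
    (h : ∀ p ∈ F.passages l, R p.1 p.2) : l.IsChain fun x y => R (F.opp x) y := by
  rw [List.isChain_iff_getElem]
  intro i hi
  refine h (F.opp l[i], l[i + 1]) ((F.mem_passages _ _ _).mpr ⟨i, by omega, rfl, ?_⟩)
  congr 1
  exact Nat.mod_eq_of_lt hi

theorem sum_map_sub_of_isChain {A : Type*} [AddCommGroup A] {f : H → A} {b : H} :
    ∀ (r : List H) (a : H), (a :: (r ++ [b])).IsChain (fun x y => f (F.opp x) = f y) →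
      ((a :: r).map fun d => f (F.opp d) - f d).sum = f b - f a
  | [], a, h => by
    simp only [List.nil_append, List.isChain_cons_cons] at h
    simp [h.1]
  | c :: r, a, h => by
    rw [List.cons_append, List.isChain_cons_cons] at h
    rw [List.map_cons, List.sum_cons, sum_map_sub_of_isChain r c h.2, h.1]
    abel

theorem sum_map_of_odd_reverseDarts {A : Type*} [AddCommGroup A] {g : H → A}
    (hg : ∀ h, g (F.opp h) = -g h) (l : List H) :
    ((F.reverseDarts l).map g).sum = -(l.map g).sum := by
  rw [reverseDarts, (((l.map F.opp).reverse_perm).map g).sum_eq]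
  induction l with
  | nil => simp
  | cons a l ih => simp only [List.map_cons, List.sum_cons, ih, hg]; abel

/-! ### Closed trails -/

theorem component_opp (h : H) : F.component (F.opp h) = F.component h := by
  by_cases e : F.inc (F.opp h) = F.inc h
  · simp [component, e]
  · refine SimpleGraph.ConnectedComponent.sound (SimpleGraph.Adj.reachable ?_)
    rw [toSimpleGraph, SimpleGraph.fromRel_adj]
    exact ⟨e, Or.inl ⟨F.opp h, rfl, by rw [opp_opp]⟩⟩

theorem mem_reverseDarts {l : List H} {h : H} : h ∈ F.reverseDarts l ↔ F.opp h ∈ l := by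
  simp only [reverseDarts, List.mem_reverse, List.mem_map]
  constructor
  · rintro ⟨a, ha, rfl⟩
    rwa [opp_opp]
  · exact fun hh => ⟨_, hh, F.opp_opp h⟩

namespace ClosedTrail

/-- The closed trail with another starting point. -/
def ofIsRotated (t : ClosedTrail F) (l : List H) (h : t.darts ~r l) : ClosedTrail F where
  darts := l
  ne_nil := fun e => t.ne_nil (List.isRotated_nil_iff.mp (e ▸ h))
  inc_eq := by
    obtain ⟨n, rfl⟩ := h
    intro p hp
    rw [passages_rotate, List.mem_rotate] at hp
    exact t.inc_eq p hp
  nodup := ((h.perm.append (h.perm.map F.opp)).nodup_iff).mp t.nodup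

theorem circuit_ofIsRotated (t : ClosedTrail F) (l : List H) (h : t.darts ~r l) :
    (t.ofIsRotated l h).circuit = t.circuit :=
  Quotient.sound (s := F.circuitSetoid) (Or.inl h.symm)

theorem nodup_darts (t : ClosedTrail F) : t.darts.Nodup :=
  (List.nodup_append.mp t.nodup).1

theorem opp_notMem (t : ClosedTrail F) {d : H} (hd : d ∈ t.darts) : F.opp d ∉ t.darts :=
  fun h => (List.nodup_append.mp t.nodup).2.2 _ h _ (List.mem_map_of_mem hd) rfl

theorem edge_mem_edges_iff (t : ClosedTrail F) (h : H) :
    F.edge h ∈ t.circuit.edges ↔ h ∈ t.darts ∨ F.opp h ∈ t.darts := by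
  constructor
  · rintro ⟨t', e, d, hd, he⟩
    have hd' : d ∈ t.darts ∨ F.opp d ∈ t.darts := by
      rcases (Quotient.exact e : t'.darts ~r t.darts ∨ t'.darts ~r F.reverseDarts t.darts)
        with r | r
      · exact Or.inl (r.perm.subset hd)
      · exact Or.inr (mem_reverseDarts.mp (r.perm.subset hd))
    rcases (F.edge_eq_iff _ _).mp he with rfl | rfl
    · exact hd'
    · rw [opp_opp] at hd'
      exact hd'.symm
  · rintro (hd | hd)
    · exact ⟨t, rfl, h, hd, rfl⟩
    · exact ⟨t, rfl, _, hd, F.edge_opp h⟩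

theorem component_eq (t : ClosedTrail F) {d d' : H} (hd : d ∈ t.darts) (hd' : d' ∈ t.darts) :
    F.component d = F.component d' := by
  let r : H → H → Prop := fun x y => F.component x = F.component y
  have : Trans r r r := ⟨fun h h' => Eq.trans h h'⟩
  have : Std.Symm r := ⟨fun _ _ h => Eq.symm h⟩
  have hc : t.darts.IsChain r := by
    have := isChain_of_passages (R := fun x y => F.component x = F.component y)
      (fun p hp => by rw [component, component, t.inc_eq p hp])
    refine List.IsChain.imp (fun x y h => ?_) this
    rw [component_opp] at h
    exact h
  have hp := List.isChain_iff_pairwise.mp hc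
  exact hp.forall_of_forall (R := r) (fun x _ => Eq.refl (F.component x)) hd hd'

/-- A closed trail in a 4-regular graph visits a vertex at most twice. -/
theorem countP_inc_le_two [DecidableEq V] (hF : F.IsFourRegular) (t : ClosedTrail F) (v : V) :
    t.darts.countP (fun d => decide (F.inc d = v)) ≤ 2 := by
  classical
  have h1 : (t.darts.map F.opp).countP (fun d => decide (F.inc d = v)) =
      t.darts.countP (fun d => decide (F.inc d = v)) := by
    rw [← (t.darts.rotate_perm 1).countP_eq]
    have e : (t.darts.map F.opp).map F.inc = (t.darts.rotate 1).map F.inc := by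
      refine List.ext_getElem (by simp) fun i hi hi' => ?_
      simp only [List.getElem_map]
      have hi1 : i < t.darts.length := by simpa using hi
      have hi2 : i < (t.darts.rotate 1).length := by simpa using hi
      refine t.inc_eq (F.opp t.darts[i], (t.darts.rotate 1)[i]) ?_
      rw [passages, List.mem_iff_getElem]
      exact ⟨i, by simpa using hi1, by simp⟩
    have := congrArg (List.countP fun w => decide (w = v)) e
    simpa only [List.countP_map, Function.comp_def] using this
  have h2 : (t.darts ++ t.darts.map F.opp).countP (fun d => decide (F.inc d = v)) ≤ 4 := by
    have h4 := hF v
    have hfin : {h : H | F.inc h = v}.Finite := Set.finite_of_ncard_ne_zero (by omega)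
    rw [List.countP_eq_length_filter, ← List.toFinset_card_of_nodup (t.nodup.filter _), ← h4,
      ← Set.ncard_coe_finset]
    refine Set.ncard_le_ncard (fun x hx => ?_) hfin
    simp only [List.coe_toFinset, List.mem_filter, Set.mem_ofPred_eq] at hx
    simpa using hx.2
  rw [List.countP_append] at h2
  omega

end ClosedTrail

/-! ### Lists that visit a place at most twice -/

theorem append_cons_inj {α : Type*} {p : α → Prop} {a a' : α} (ha : p a) (ha' : p a') :
    ∀ {X X' Y Y' : List α}, (∀ x ∈ X, ¬p x) → (∀ x ∈ X', ¬p x) →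
      X ++ a :: Y = X' ++ a' :: Y' → X = X' ∧ a = a' ∧ Y = Y'
  | [], [], Y, Y', _, _, e => by simpa using e
  | [], x :: X', Y, Y', _, h', e => by
    simp only [List.nil_append, List.cons_append, List.cons.injEq] at e
    exact absurd (e.1 ▸ ha) (h' x (by simp))
  | x :: X, [], Y, Y', h, _, e => by
    simp only [List.nil_append, List.cons_append, List.cons.injEq] at e
    exact absurd (e.1 ▸ ha') (h x (by simp))
  | x :: X, x' :: X', Y, Y', h, h', e => by
    simp only [List.cons_append, List.cons.injEq] at e
    obtain ⟨e1, e2, e3⟩ := append_cons_inj ha ha' (fun y hy => h y (by simp [hy]))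
      (fun y hy => h' y (by simp [hy])) e.2
    exact ⟨by rw [e.1, e1], e2, e3⟩

theorem eq_of_countP_le_two {α : Type*} {p : α → Prop} [DecidablePred p]
    {a a' c c' : α} (ha : p a) (ha' : p a') (hc : p c) (hc' : p c') {X X' Y Y' Z Z' : List α}
    (hl : (X ++ a :: (Y ++ c :: Z)).countP (fun x => decide (p x)) ≤ 2)
    (e : X ++ a :: (Y ++ c :: Z) = X' ++ a' :: (Y' ++ c' :: Z')) :
    a :: Y = a' :: Y' := by
  have hl' := hl
  rw [e] at hl'
  simp only [List.countP_append, List.countP_cons, ha, hc, decide_true, if_true, ha', hc']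
    at hl hl'
  have h0 : ∀ l : List α, l.countP (fun x => decide (p x)) = 0 → ∀ x ∈ l, ¬p x :=
    fun l h x hx => by
      simpa using List.countP_eq_zero.mp h x hx
  obtain ⟨-, e1, e2⟩ := append_cons_inj ha ha' (h0 X (by omega)) (h0 X' (by omega)) e
  obtain ⟨e3, -, -⟩ := append_cons_inj hc hc' (h0 Y (by omega)) (h0 Y' (by omega)) e2
  rw [e1, e3]

theorem eq_of_cons_isRotated {α : Type*} {b : α} {l l' : List α} (hn : (b :: l).Nodup)
    (h : b :: l ~r b :: l') : l = l' := by
  obtain ⟨n, hn'⟩ := h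
  have h0 : n % (b :: l).length < (b :: l).length := Nat.mod_lt _ (by simp)
  have : ((b :: l).rotate n)[0]'(by simp) = b := by simp [hn']
  rw [List.getElem_rotate] at this
  have h1 : (0 + n) % (b :: l).length = 0 := by
    refine (hn.getElem_inj_iff (hi := by simpa using h0) (hj := by simp)).mp ?_
    rw [this]; rfl
  rw [← List.rotate_mod, ← Nat.zero_add n, h1, List.rotate_zero] at hn'
  simpa using hn'

/-! ### The rows of the matrix as boundaries -/

section Rows

variable {hF : F.IsFourRegular} {P : CircuitPartition F}

open Classical in
/-- The indicator, in the `w` coordinate, of the half-edges whose shadow is the initial half-edge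
of `e_w`. -/
noncomputable def initialIndicator (R : Type*) [Ring R]
    (D : DirectedVersion (P.touchGraph hF)) (h : H) (w : V) : R :=
  if P.shadow h = D.initial w then 1 else 0

variable (D : DirectedVersion (P.touchGraph hF))

theorem shadow_eq_opp {h h' : H} (hi : F.inc h = F.inc h')
    (hs : P.shadow h ≠ P.shadow h') : P.shadow h' = (P.touchGraph hF).opp (P.shadow h) := by
  rcases ((P.touchGraph hF).edge_eq_iff (P.shadow h') (P.shadow h)).mp hi.symm with e | e
  · exact absurd e.symm hs
  · exact e

theorem shadow_eq_initial_or (h : H) : P.shadow h = D.initial (F.inc h) ∨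
    P.shadow h = (P.touchGraph hF).opp (D.initial (F.inc h)) :=
  ((P.touchGraph hF).edge_eq_iff _ _).mp (D.edge_initial (F.inc h)).symm

theorem initialIndicator_of_ne (R : Type*) [Ring R] {h : H} {w : V} (hw : F.inc h ≠ w) :
    initialIndicator R D h w = 0 :=
  if_neg fun e => hw (by
    have := D.edge_initial w
    rw [← e] at this
    exact this)

theorem initialIndicator_congr (R : Type*) [Ring R] {h h' : H}
    (e : P.shadow h = P.shadow h') : initialIndicator R D h = initialIndicator R D h' := by
  funext w
  rw [initialIndicator, initialIndicator, e]

theorem tally_shadowWalk (R : Type*) [Ring R] {l : List H}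
    (hl : ∀ p ∈ F.passages l, F.inc p.1 = F.inc p.2 ∧ p.1 ≠ p.2) (w : V) :
    D.tally R (P.shadowWalk l) w =
      (l.map fun d => initialIndicator R D (F.opp d) w - initialIndicator R D d w).sum := by
  classical
  rw [← sum_map_passages_sub (fun h => initialIndicator R D h w), DirectedVersion.tally,
    CircuitPartition.shadowWalk]
  generalize F.passages l = L at hl ⊢
  induction L with
  | nil => simp
  | cons p L ih =>
    have ih := ih fun q hq => hl q (by simp [hq])
    obtain ⟨hp, hne⟩ := hl p (by simp)
    rw [List.map_cons, List.sum_cons, ← ih, List.filterMap_cons]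
    by_cases hs : P.SingleTransition p.1 p.2
    · rw [initialIndicator_congr D R ((P.shadow_eq_iff _ _).mpr (Or.inr hs))]
      simp [hs]
    · simp only [hs, if_false, List.map_cons, List.sum_cons]
      congr 1
      by_cases hw : F.inc p.1 = w
      · have hE : (P.touchGraph hF).edge (P.shadow p.1) = w := hw
        rw [if_pos hE]
        by_cases hpp : P.shadow p.1 = P.shadow p.2
        · rcases (P.shadow_eq_iff _ _).mp hpp with e | e
          · exact absurd e hne
          · exact absurd e hs
        · have h1 := shadow_eq_opp (hF := hF) hp hpp
          rw [initialIndicator, initialIndicator]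
          subst hw
          rcases shadow_eq_initial_or D p.1 with e | e
          · have : P.shadow p.2 ≠ D.initial (F.inc p.1) := fun e' => hpp (e.trans e'.symm)
            simp [e, this]
          · have h2 : P.shadow p.2 = D.initial (F.inc p.1) := by
              rw [h1, e, opp_opp]
            have h3 : P.shadow p.1 ≠ D.initial (F.inc p.1) := fun e' => hpp (e'.trans h2.symm)
            simp [h2, h3]
      · have hE : ¬ (P.touchGraph hF).edge (P.shadow p.1) = w := hw
        rw [if_neg hE, initialIndicator_of_ne D R hw,
          initialIndicator_of_ne D R (fun e => hw (hp.trans e)), sub_zero]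

theorem shadowMatrix_apply (R : Type*) [Ring R] {C : EulerSystem F} (Γ : FundamentalCircuits C)
    (v w : V) : shadowMatrix R Γ P D v w = ((Γ.at_ v).darts.map fun d =>
      initialIndicator R D (F.opp d) w - initialIndicator R D d w).sum :=
  tally_shadowWalk D R (fun p hp => ⟨(Γ.at_ v).inc_eq p hp,
    ((Γ.at_ v).consecutive_ne (Or.inl hp)).symm⟩) w

theorem shadowMatrix_eq_map (R : Type*) [Ring R] {C : EulerSystem F}
    (Γ : FundamentalCircuits C) :
    shadowMatrix R Γ P D = (shadowMatrix ℤ Γ P D).map (Int.castRingHom R) := by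
  ext v w
  rw [Matrix.map_apply, shadowMatrix_apply, shadowMatrix_apply, map_list_sum, List.map_map]
  congr 2
  funext d
  simp [initialIndicator]

/-- If some edge of the touch-graph is not a loop, then the cut of the touch-graph at one end of
this edge gives a linear relation between the columns of the matrix. -/
theorem det_shadowMatrix_eq_zero [Fintype V] [DecidableEq V] {C : EulerSystem F}
    (Γ : FundamentalCircuits C) {v : V}
    (hv : P.shadowInc (D.initial v) ≠ P.shadowInc ((P.touchGraph hF).opp (D.initial v))) :
    (shadowMatrix ℤ Γ P D).det = 0 := by
  classical
  let k : P.ShadowHalfEdge → ℤ := fun q =>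
    if P.shadowInc q = P.shadowInc (D.initial v) then 1 else 0
  let o : V → ℤ := fun w => k ((P.touchGraph hF).opp (D.initial w))
  let y : V → ℤ := fun w => k (D.initial w) - o w
  refine Matrix.exists_mulVec_eq_zero_iff.mp ⟨y, fun h0 => ?_, ?_⟩
  · have : y v = 0 := congrFun h0 v
    simp [y, o, k, hv.symm] at this
  · have hs : ∀ h : H, ∑ w, initialIndicator ℤ D h w * y w = k (P.shadow h) - o (F.inc h) := by
      intro h
      rw [Finset.sum_eq_single (F.inc h)
        (fun w _ hw => by rw [initialIndicator_of_ne D ℤ hw.symm, zero_mul]) (by simp)]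
      rcases shadow_eq_initial_or D h with e | e
      · simp only [initialIndicator, e, if_true, one_mul, y]
      · rw [initialIndicator, if_neg (by rw [e]; exact opp_ne _ _), e]
        simp [o]
    funext u
    have hrow : ∀ l : List H, ∑ w, (l.map fun d =>
        initialIndicator ℤ D (F.opp d) w - initialIndicator ℤ D d w).sum * y w =
        (l.map fun d => (k (P.shadow (F.opp d)) - o (F.inc (F.opp d))) -
          (k (P.shadow d) - o (F.inc d))).sum := by
      intro l
      induction l with
      | nil => simp
      | cons a l ih =>
        simp only [List.map_cons, List.sum_cons, add_mul, sub_mul, Finset.sum_add_distrib,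
          Finset.sum_sub_distrib, hs, ih]
    simp only [Matrix.mulVec, dotProduct, shadowMatrix_apply, Pi.zero_apply, hrow]
    have ho := sum_map_sub_eq_zero (f := fun h => o (F.inc h)) (l := (Γ.at_ u).darts)
      (fun p hp => by rw [(Γ.at_ u).inc_eq p hp])
    have hk : ((Γ.at_ u).darts.map fun d => k (P.shadow (F.opp d)) - k (P.shadow d)).sum = 0 := by
      rw [List.map_congr_left (g := fun _ => (0 : ℤ)) (fun d _ => ?_)]
      · simp
      · have : P.shadowInc (P.shadow (F.opp d)) = P.shadowInc (P.shadow d) := by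
          refine Subtype.ext (P.eq_circuitOf (P.circuitOf_mem (F.opp d)) ?_)
          rw [← F.edge_opp d]
          exact P.edge_mem_circuitOf _
        simp only [k, this, sub_self]
    have := congrArg₂ (· - ·) hk ho
    simp only [sum_map_sub_distrib] at this ⊢
    linarith

end Rows

/-! ### Potentials -/

section Potential

variable {A : Type*} [AddCommGroup A] {g : H → A} {C : EulerSystem F}

theorem EulerSystem.edge_mem_iff {γ : Circuit F} (hγ : γ ∈ C.circuits) {h₀ : H}
    (h₀γ : F.edge h₀ ∈ γ.edges) (h : H) :
    F.edge h ∈ γ.edges ↔ F.component h = F.component h₀ := by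
  obtain ⟨c, hc⟩ := C.euler γ hγ
  rw [hc h, (hc h₀).mp h₀γ]

theorem EulerSystem.eq_of_edge_mem {γ γ' : Circuit F} (hγ : γ ∈ C.circuits)
    (hγ' : γ' ∈ C.circuits) {h h' : H} (hh : F.edge h ∈ γ.edges) (hh' : F.edge h' ∈ γ'.edges)
    (hc : F.component h = F.component h') : γ = γ' :=
  (C.unique (F.component h)).unique ⟨hγ, C.edge_mem_iff hγ hh⟩
    ⟨hγ', by rw [hc]; exact C.edge_mem_iff hγ' hh'⟩

theorem exists_cons_append_of_isRotated {b : H} {L t s : List H} {v : V}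
    (hn : (b :: L).Nodup) (hr : b :: L ~r t ++ s) (hb : b ∉ t)
    (ht : ∃ a t', t = a :: t' ∧ F.inc a = v) (hs : ∃ c s', s = c :: s' ∧ F.inc c = v)
    (hg : (t.map g).sum = 0) :
    ∃ X a Y c Z, L ++ [b] = X ++ a :: (Y ++ c :: Z) ∧ F.inc a = v ∧ F.inc c = v ∧
      ((a :: Y).map g).sum = 0 := by
  have hbs : b ∈ s := (List.mem_append.mp (hr.perm.subset (by simp))).resolve_left hb
  obtain ⟨s1, s2, rfl⟩ := List.append_of_mem hbs
  obtain ⟨a, t', rfl, ha⟩ := ht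
  have hr' : b :: L ~r b :: (s2 ++ (a :: t' ++ s1)) := by
    refine hr.trans ?_
    have := List.isRotated_append (l := a :: t' ++ s1) (l' := b :: s2)
    simpa [List.append_assoc] using this
  have hL := eq_of_cons_isRotated hn hr'
  obtain ⟨c, s', hs, hc⟩ := hs
  cases s1 with
  | nil =>
    refine ⟨s2, a, t', b, [], by simp [hL], ha, ?_, hg⟩
    simp only [List.nil_append, List.cons.injEq] at hs
    rw [hs.1, hc]
  | cons c' s1 =>
    refine ⟨s2, a, t', c', s1 ++ [b], by simp [hL], ha, ?_, hg⟩
    simp only [List.cons_append, List.cons.injEq] at hs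
    rw [hs.1, hc]

theorem exists_head_reverseDarts {t s : List H} {v : V}
    (hp : ∀ p ∈ F.passages (t ++ s), F.inc p.1 = F.inc p.2) (ht : t ≠ [])
    (hs : ∃ c s', s = c :: s' ∧ F.inc c = v) :
    ∃ a t', F.reverseDarts t = a :: t' ∧ F.inc a = v := by
  obtain ⟨c, s', rfl, rfl⟩ := hs
  obtain ⟨t', x, rfl⟩ := List.eq_nil_or_concat t |>.resolve_left ht
  refine ⟨F.opp x, F.reverseDarts t', by simp [reverseDarts], ?_⟩
  have := isChain_of_passages (R := fun x y => F.inc x = F.inc y) hp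
  rw [List.concat_eq_append, List.append_assoc, List.singleton_append] at this
  have := List.isChain_split.mp this
  rw [List.isChain_cons_cons] at this
  exact this.2.1

theorem exists_visit_segments (hg : ∀ h, g (F.opp h) = -g h) {T : ClosedTrail F} {b : H}
    {L : List H} (hT : T.darts = b :: L) (hTC : T.circuit ∈ C.circuits) {v : V} {t : ClosedTrail F}
    (hv : F.toSimpleGraph.connectedComponentMk v = F.component b) (ht : C.IsFundamental v t)
    (hb : F.edge b ∉ t.circuit.edges) (hgt : (t.darts.map g).sum = 0) :
    ∃ X a Y c Z, L ++ [b] = X ++ a :: (Y ++ c :: Z) ∧ F.inc a = v ∧ F.inc c = v ∧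
      ((a :: Y).map g).sum = 0 := by
  obtain ⟨hst, s, c, hss, hc, hcC⟩ := ht
  rw [ClosedTrail.edge_mem_edges_iff, not_or] at hb
  have head : ∀ u : ClosedTrail F, u.start = v → ∃ a t', u.darts = a :: t' ∧ F.inc a = v := by
    intro u hu
    refine ⟨u.darts.head u.ne_nil, u.darts.tail, (List.cons_head_tail _).symm, hu⟩
  obtain ⟨a, t', hat, ha⟩ := head t hst
  have hbT : F.edge b ∈ T.circuit.edges := (T.edge_mem_edges_iff b).mpr (by simp [hT])
  have hac : F.edge a ∈ c.circuit.edges := (c.edge_mem_edges_iff a).mpr (by simp [hc, hat])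
  have e : T.circuit = c.circuit := C.eq_of_edge_mem hTC hcC hbT hac (by
    rw [← hv, ← ha]; rfl)
  have hn := hT ▸ T.nodup_darts
  rcases (Quotient.exact e : T.darts ~r c.darts ∨ T.darts ~r F.reverseDarts c.darts) with r | r
  · rw [hT, hc] at r
    exact exists_cons_append_of_isRotated hn r hb.1 ⟨a, t', hat, ha⟩ (head s hss) hgt
  · have r' : b :: L ~r F.reverseDarts t.darts ++ F.reverseDarts s.darts := by
      rw [← hT]
      refine r.trans ?_
      have := List.isRotated_append (l := F.reverseDarts s.darts) (l' := F.reverseDarts t.darts)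
      rw [hc]
      simpa [reverseDarts] using this
    have hp := c.inc_eq
    rw [hc] at hp
    have hp' : ∀ p ∈ F.passages (s.darts ++ t.darts), F.inc p.1 = F.inc p.2 :=
      (c.ofIsRotated (s.darts ++ t.darts) (by rw [hc]; exact List.isRotated_append)).inc_eq
    refine exists_cons_append_of_isRotated hn r' (fun h => hb.2 (mem_reverseDarts.mp h))
      (exists_head_reverseDarts hp t.ne_nil (head s hss))
      (exists_head_reverseDarts hp' s.ne_nil (head t hst)) ?_
    rw [sum_map_of_odd_reverseDarts hg, hgt, neg_zero]

theorem sum_eq_of_inc_eq (hF : F.IsFourRegular) (hg : ∀ h, g (F.opp h) = -g h)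
    {T : ClosedTrail F} {b : H} {L : List H} (hT : T.darts = b :: L)
    (hTC : T.circuit ∈ C.circuits) {Γ : FundamentalCircuits C}
    (hb : ∀ v, F.edge b ∉ (Γ.at_ v).circuit.edges) (hgΓ : ∀ v, ((Γ.at_ v).darts.map g).sum = 0)
    {X X' Y Y' : List H} {a a' : H} (h : L ++ [b] = X ++ a :: Y) (h' : L ++ [b] = X' ++ a' :: Y')
    (haa' : F.inc a = F.inc a') : (X.map g).sum = (X'.map g).sum := by
  classical
  have key : ∀ {X X' Y Y' : List H} {a a' : H}, L ++ [b] = X ++ a :: Y → F.inc a = F.inc a' →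
      ∀ as, X' = X ++ as → a :: Y = as ++ a' :: Y' → (X.map g).sum = (X'.map g).sum := by
    rintro X X' Y Y' a a' h haa' (_ | ⟨a₁, as⟩) rfl h2
    · simp
    · simp only [List.cons_append, List.cons.injEq] at h2
      obtain ⟨rfl, rfl⟩ := h2
      have haT : a ∈ T.darts := by
        have : a ∈ L ++ [b] := by simp [h]
        rw [hT]
        simpa [or_comm] using this
      obtain ⟨X₁, a₁, Y₁, c₁, Z₁, e, ha₁, hc₁, hs⟩ := exists_visit_segments (v := F.inc a) hg hT hTC
        (T.component_eq haT (by simp [hT])) (Γ.fundamental _) (hb _) (hgΓ _)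
      have hcount := T.countP_inc_le_two hF (F.inc a)
      have hperm : T.darts.Perm (X ++ a :: (as ++ a' :: Y')) := by
        rw [hT, ← h]
        exact (List.perm_append_singleton b L).symm
      rw [hperm.countP_eq] at hcount
      have := eq_of_countP_le_two (p := fun d => F.inc d = F.inc a) rfl ha₁ haa'.symm hc₁ hcount
        (h.symm.trans e)
      rw [this, List.map_append, List.sum_append, hs, add_zero]
  rcases List.append_eq_append_iff.mp (h.symm.trans h') with ⟨as, h1, h2⟩ | ⟨as, h1, h2⟩
  · exact key h haa' as h1 h2
  · exact (key h' haa'.symm as h1 h2).symm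

theorem exists_eulerTrail {B : Set E} (hB : F.IsBaseSet B)
    (c : F.toSimpleGraph.ConnectedComponent) :
    ∃ (T : ClosedTrail F) (b : H) (L : List H), T.darts = b :: L ∧ T.circuit ∈ C.circuits ∧
      F.edge b ∈ B ∧ ∀ h, F.component h = c ↔ F.edge h ∈ T.circuit.edges := by
  obtain ⟨e, ⟨heB, h, rfl, hc⟩, -⟩ := hB c
  obtain ⟨γ, ⟨hγ, hγc⟩, -⟩ := C.unique c
  obtain ⟨t, rfl, d, hd, hde⟩ := (hγc h).mpr hc
  obtain ⟨X, Y, hXY⟩ := List.append_of_mem hd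
  have hr : t.darts ~r d :: (Y ++ X) := by
    rw [hXY, ← List.cons_append]
    exact List.isRotated_append
  refine ⟨t.ofIsRotated _ hr, d, _, rfl, ?_, hde ▸ heB, fun h => ?_⟩
  · rwa [ClosedTrail.circuit_ofIsRotated]
  · rw [ClosedTrail.circuit_ofIsRotated, hγc]

/-- An odd function on the half-edges that adds up to zero around the fundamental circuits is the
coboundary of a potential away from the base edges. -/
theorem exists_potential_off_base (hF : F.IsFourRegular) (hg : ∀ h, g (F.opp h) = -g h)
    {Γ : FundamentalCircuits C} {B : Set E} (hΓ : Γ.IsBasedAt B)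
    (hgΓ : ∀ v, ((Γ.at_ v).darts.map g).sum = 0) :
    ∃ φ : V → A, ∀ d, F.edge d ∉ B → g d = φ (F.inc (F.opp d)) - φ (F.inc d) := by
  classical
  choose T b L hT hTC hbB hcomp using exists_eulerTrail (C := C) hΓ.1
  let cmp : V → F.toSimpleGraph.ConnectedComponent := F.toSimpleGraph.connectedComponentMk
  let φ : V → A := fun v =>
    if h : ∃ X a Y, L (cmp v) ++ [b (cmp v)] = X ++ a :: Y ∧ F.inc a = v then
      (h.choose.map g).sum else 0
  have hφ : ∀ (a : H) (X Y : List H),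
      L (F.component a) ++ [b (F.component a)] = X ++ a :: Y → φ (F.inc a) = (X.map g).sum := by
    intro a X Y e
    have h : ∃ X a' Y, L (cmp (F.inc a)) ++ [b (cmp (F.inc a))] = X ++ a' :: Y ∧
      F.inc a' = F.inc a := ⟨X, a, Y, e, rfl⟩
    have : φ (F.inc a) = (h.choose.map g).sum := dif_pos h
    rw [this]
    obtain ⟨a', Y', e', ha'⟩ := h.choose_spec
    exact sum_eq_of_inc_eq hF hg (hT _) (hTC _) (fun v => hΓ.2 v _ (hbB _)) hgΓ e' e ha'
  refine ⟨φ, ?_⟩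
  have main : ∀ d, F.edge d ∉ B → d ∈ (T (F.component d)).darts →
      g d = φ (F.inc (F.opp d)) - φ (F.inc d) := by
    intro d hdB hd
    set c := F.component d with hc
    rw [hT, List.mem_cons] at hd
    obtain ⟨X, Y, hXY⟩ := List.append_of_mem (hd.resolve_left fun e => hdB (e ▸ hbB c))
    obtain ⟨a, Z, haZ⟩ : ∃ a Z, Y ++ [b c] = a :: Z := by
      cases Y with
      | nil => exact ⟨_, _, rfl⟩
      | cons y Y => exact ⟨_, _, rfl⟩
    have e : L c ++ [b c] = X ++ d :: a :: Z := by simp [hXY, ← haZ]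
    have hr : (T c).darts ~r L c ++ [b c] := by
      rw [hT, ← List.singleton_append]
      exact List.isRotated_append
    have hchain := isChain_of_passages (R := fun x y => F.inc x = F.inc y) ((T c).ofIsRotated _ hr).inc_eq
    have hda : F.inc (F.opp d) = F.inc a := by
      have hchain : (L c ++ [b c]).IsChain fun x y => F.inc (F.opp x) = F.inc y := hchain
      rw [e] at hchain
      exact (List.isChain_cons_cons.mp (List.isChain_split.mp hchain).2).1
    have hca : F.component a = c := by
      rw [hc, ← component_opp d, component, component, hda]
    rw [hda, hφ d X _ e, hφ a (X ++ [d]) Z (by rw [hca]; simp [e])]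
    simp
  intro d hd
  rcases ((T (F.component d)).edge_mem_edges_iff d).mp ((hcomp _ d).mp rfl) with h | h
  · exact main d hd h
  · have := main (F.opp d) (by rwa [edge_opp]) (by rwa [component_opp])
    rw [hg, opp_opp] at this
    rw [← neg_neg (g d), this, neg_sub]

/-- An odd function on the half-edges that adds up to zero around the fundamental circuits and
around the circuits of a circuit partition is the coboundary of a potential. -/
theorem exists_potential (hF : F.IsFourRegular) (hg : ∀ h, g (F.opp h) = -g h)
    {Γ : FundamentalCircuits C} {B : Set E} (hΓ : Γ.IsBasedAt B)
    (hgΓ : ∀ v, ((Γ.at_ v).darts.map g).sum = 0) (P : CircuitPartition F)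
    (hgP : ∀ t : ClosedTrail F, t.circuit ∈ P.circuits → (t.darts.map g).sum = 0) :
    ∃ φ : V → A, ∀ d, g d = φ (F.inc (F.opp d)) - φ (F.inc d) := by
  classical
  obtain ⟨φ, hφ⟩ := exists_potential_off_base hF hg hΓ hgΓ
  refine ⟨φ, ?_⟩
  have main : ∀ (d : H) (t : ClosedTrail F), t.circuit ∈ P.circuits → d ∈ t.darts →
      F.edge d ∈ B → g d = φ (F.inc (F.opp d)) - φ (F.inc d) := by
    intro d t ht hd hdB
    have h0 := sum_map_sub_eq_zero (f := fun h => φ (F.inc h)) (l := t.darts)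
      (fun p hp => by rw [t.inc_eq p hp])
    have h1 := hgP t ht
    obtain ⟨X, Y, hXY⟩ := List.append_of_mem hd
    have hn := t.nodup_darts
    have hz : ∀ x ∈ t.darts, x ≠ d → g x - (φ (F.inc (F.opp x)) - φ (F.inc x)) = 0 := by
      intro x hx hxd
      rw [sub_eq_zero]
      refine hφ x fun hxB => ?_
      have : F.edge x = F.edge d := (hΓ.1 (F.component d)).unique
        ⟨hxB, x, rfl, t.component_eq hx hd⟩ ⟨hdB, d, rfl, rfl⟩
      rcases (F.edge_eq_iff _ _).mp this with e | e
      · exact hxd e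
      · exact t.opp_notMem hd (e ▸ hx)
    have h2 : (t.darts.map fun x => g x - (φ (F.inc (F.opp x)) - φ (F.inc x))).sum = 0 := by
      rw [sum_map_sub_distrib, h1, h0, sub_zero]
    rw [hXY, List.nodup_middle, List.nodup_cons, List.mem_append, not_or] at hn
    have hX : ∀ l : List H, l ⊆ t.darts → d ∉ l →
        (l.map fun x => g x - (φ (F.inc (F.opp x)) - φ (F.inc x))).sum = 0 := by
      intro l hl hdl
      rw [List.map_congr_left (g := fun _ => (0 : A))
        (fun x hx => hz x (hl hx) (fun e => hdl (e ▸ hx)))]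
      simp
    have hX1 := hX X (by rw [hXY]; exact List.subset_append_left _ _) hn.1.1
    have hY1 := hX Y (by
      rw [hXY]
      exact fun x hx => List.mem_append_right _ (List.mem_cons_of_mem _ hx)) hn.1.2
    rw [hXY, List.map_append, List.sum_append, List.map_cons, List.sum_cons, hX1, hY1, zero_add,
      add_zero] at h2
    exact sub_eq_zero.mp h2
  intro d
  by_cases hd : F.edge d ∈ B
  · obtain ⟨t, ht⟩ : ∃ t : ClosedTrail F, t.circuit = P.circuitOf d := Quotient.exists_rep _
    have hm := P.edge_mem_circuitOf d
    have htP : t.circuit ∈ P.circuits := ht ▸ P.circuitOf_mem d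
    rw [← ht] at hm
    rcases (t.edge_mem_edges_iff d).mp hm with h | h
    · exact main d t htP h hd
    · have := main (F.opp d) t htP h (by rwa [edge_opp])
      rw [hg, opp_opp] at this
      rw [← neg_neg (g d), this, neg_sub]
  · exact hφ d hd

end Potential

/-! ### The determinant when every edge of the touch-graph is a loop -/

section Unimodular

variable {hF : F.IsFourRegular} {P : CircuitPartition F}

theorem shadow_eq_of_mem_passages {t : ClosedTrail F} (ht : t.circuit ∈ P.circuits) :
    ∀ p ∈ F.passages t.darts, P.shadow p.1 = P.shadow p.2 :=
  fun _ hp => (P.shadow_eq_iff _ _).mpr (Or.inr ⟨t, ht, Or.inl hp⟩)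

theorem exists_dart_of_shadowInc {t : ClosedTrail F} (ht : t.circuit ∈ P.circuits)
    {q : P.ShadowHalfEdge} (hq : (P.shadowInc q : Circuit F) = t.circuit) :
    ∃ a ∈ t.darts, P.shadow a = q := by
  obtain ⟨h, rfl⟩ : ∃ h, P.shadow h = q := Quotient.exists_rep q
  have hm := P.edge_mem_circuitOf h
  have hq' : P.circuitOf h = t.circuit := hq
  rw [hq', ClosedTrail.edge_mem_edges_iff] at hm
  rcases hm with hm | hm
  · exact ⟨h, hm, rfl⟩
  · obtain ⟨i, hi, e⟩ := List.mem_iff_getElem.mp hm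
    refine ⟨_, List.getElem_mem (Nat.mod_lt (i + 1) (by omega)), (shadow_eq_of_mem_passages ht
      (h, _) ((F.mem_passages _ _ _).mpr ⟨i, hi, ?_, rfl⟩)).symm⟩
    rw [e, opp_opp]

/-- The boundary of a half-edge in the coordinates given by the touch-graph. -/
noncomputable def dartVector (D : DirectedVersion (P.touchGraph hF)) (d : H) : V → ℤ :=
  initialIndicator ℤ D (F.opp d) - initialIndicator ℤ D d

variable (D : DirectedVersion (P.touchGraph hF))

theorem dartVector_opp (d : H) : dartVector D (F.opp d) = -dartVector D d := by
  simp [dartVector, opp_opp]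

theorem sum_dartVector_eq_zero {t : ClosedTrail F} (ht : t.circuit ∈ P.circuits) :
    (t.darts.map (dartVector D)).sum = 0 :=
  sum_map_sub_eq_zero (f := initialIndicator ℤ D)
    fun p hp => initialIndicator_congr D ℤ (shadow_eq_of_mem_passages ht p hp)

theorem shadowMatrix_row {C : EulerSystem F} (Γ : FundamentalCircuits C) (v : V) :
    shadowMatrix ℤ Γ P D v = ((Γ.at_ v).darts.map (dartVector D)).sum := by
  funext w
  rw [shadowMatrix_apply, ← Pi.evalAddMonoidHom_apply (fun _ : V => ℤ) w
    ((Γ.at_ v).darts.map (dartVector D)).sum, map_list_sum, List.map_map]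
  rfl

/-- If the edge `e_v` of the touch-graph is a loop, then the two single transitions at `v` cut a
segment out of a circuit of `P`, and this segment represents the unit vector at `v`. -/
theorem exists_segment [DecidableEq V] {v : V}
    (hv : P.shadowInc (D.initial v) = P.shadowInc ((P.touchGraph hF).opp (D.initial v))) :
    ∃ (a b : H) (r : List H), F.inc a = F.inc b ∧
      (a :: (r ++ [b])).IsChain (fun x y => F.inc (F.opp x) = F.inc y) ∧
      ((a :: r).map (dartVector D)).sum = -Pi.single v 1 := by
  obtain ⟨t, ht⟩ : ∃ t : ClosedTrail F, t.circuit = P.shadowInc (D.initial v) :=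
    Quotient.exists_rep _
  have htP : t.circuit ∈ P.circuits := ht ▸ (P.shadowInc (D.initial v)).2
  obtain ⟨a, hat, ha⟩ := exists_dart_of_shadowInc htP ht.symm
  obtain ⟨b, hbt, hb⟩ := exists_dart_of_shadowInc htP (hv ▸ ht.symm)
  have hab : P.shadow a ≠ P.shadow b := by
    rw [ha, hb]
    exact (opp_ne _ _).symm
  have hav : F.inc a = v := by
    change P.shadowEdge (P.shadow a) = v
    rw [ha]
    exact D.edge_initial v
  have hbv : F.inc b = v := by
    change P.shadowEdge (P.shadow b) = v
    rw [hb]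
    exact ((P.touchGraph hF).edge_opp _).trans (D.edge_initial v)
  obtain ⟨X, Y, hXY⟩ := List.append_of_mem hat
  have hr : t.darts ~r a :: (Y ++ X) := by
    rw [hXY, ← List.cons_append]
    exact List.isRotated_append
  have hb' : b ∈ Y ++ X :=
    (List.mem_cons.mp (hr.perm.subset hbt)).resolve_left fun e => hab (e ▸ rfl)
  obtain ⟨r, Z, hrZ⟩ := List.append_of_mem hb'
  have hu : (t.ofIsRotated _ hr).circuit ∈ P.circuits := by
    rwa [ClosedTrail.circuit_ofIsRotated]
  have hsplit : a :: (Y ++ X) = (a :: (r ++ [b])) ++ Z := by simp [hrZ]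
  have hinc : (a :: (Y ++ X)).IsChain fun x y => F.inc (F.opp x) = F.inc y :=
    isChain_of_passages (R := fun x y => F.inc x = F.inc y) (t.ofIsRotated _ hr).inc_eq
  have hsh : (a :: (Y ++ X)).IsChain
      fun x y => initialIndicator ℤ D (F.opp x) = initialIndicator ℤ D y :=
    isChain_of_passages (R := fun x y => initialIndicator ℤ D x = initialIndicator ℤ D y)
      (fun p hp => initialIndicator_congr D ℤ (shadow_eq_of_mem_passages hu p hp))
  rw [hsplit] at hinc hsh
  refine ⟨a, b, r, hav.trans hbv.symm, hinc.left_of_append, ?_⟩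
  have := sum_map_sub_of_isChain r a hsh.left_of_append
  refine this.trans ?_
  funext w
  by_cases hw : w = v
  · subst hw
    have : P.shadow b ≠ D.initial w := fun e => hab (ha.trans e.symm)
    simp [initialIndicator, ha, this]
  · rw [Pi.sub_apply, initialIndicator_of_ne D ℤ (by rw [hbv]; exact Ne.symm hw),
      initialIndicator_of_ne D ℤ (by rw [hav]; exact Ne.symm hw)]
    simp [hw]

theorem isUnit_det_shadowMatrix [Fintype V] [DecidableEq V] {C : EulerSystem F} {B : Set E}
    {Γ : FundamentalCircuits C} (hΓ : Γ.IsBasedAt B)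
    (hv : ∀ v, P.shadowInc (D.initial v) = P.shadowInc ((P.touchGraph hF).opp (D.initial v))) :
    IsUnit (shadowMatrix ℤ Γ P D).det := by
  set M := shadowMatrix ℤ Γ P D with hM
  let S : Submodule ℤ (V → ℤ) := Submodule.span ℤ (Set.range M)
  let g : H → (V → ℤ) ⧸ S := fun d => S.mkQ (dartVector D d)
  have hsum : ∀ l : List H, (l.map g).sum = S.mkQ (l.map (dartVector D)).sum := fun l => by
    rw [map_list_sum, List.map_map]
    rfl
  obtain ⟨φ, hφ⟩ := exists_potential (g := g) hF
    (fun h => by simp only [g, dartVector_opp, map_neg]) hΓ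
    (fun v => by
      rw [hsum, ← shadowMatrix_row]
      exact (Submodule.Quotient.mk_eq_zero S).mpr (Submodule.subset_span ⟨v, rfl⟩))
    P (fun t ht => by rw [hsum, sum_dartVector_eq_zero D ht, map_zero])
  have hmem : ∀ v, Pi.single v 1 ∈ Submodule.span ℤ (Set.range M) := by
    intro v
    obtain ⟨a, b, r, hab, hc, hs⟩ := exists_segment D (hv v)
    have h0 : ((a :: r).map g).sum = 0 := by
      rw [List.map_congr_left (fun d _ => hφ d),
        sum_map_sub_of_isChain (f := fun h => φ (F.inc h)) r a
          (hc.imp fun x y e => by rw [e]), hab, sub_self]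
    rw [hsum, hs] at h0
    have := (Submodule.Quotient.mk_eq_zero S).mp h0
    exact (Submodule.neg_mem_iff S).mp this
  choose N hN using fun v => (Submodule.mem_span_range_iff_exists_fun ℤ).mp (hmem v)
  have hNM : Matrix.of N * M = 1 := by
    ext v w
    have := congrFun (hN v) w
    rw [Finset.sum_apply] at this
    simpa [Matrix.mul_apply, Matrix.one_apply, Pi.single_apply, eq_comm] using this
  exact IsUnit.of_mul_eq_one_right _ (by rw [← Matrix.det_mul, hNM, Matrix.det_one])

end Unimodular

end HalfEdgeGraph

theorem mainTheorem5 {V E H : Type*} [Fintype V] [DecidableEq V]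
    (F : HalfEdgeGraph V E H) (hF : F.IsFourRegular)
    (C : F.EulerSystem) (B : Set E) (Γ : HalfEdgeGraph.FundamentalCircuits C)
    (hΓ : Γ.IsBasedAt B)
    (P : F.CircuitPartition) (D : (P.touchGraph hF).DirectedVersion) :
    (HalfEdgeGraph.shadowMatrix ℝ Γ P D).det ∈ ({-1, 0, 1} : Set ℝ) := by
  rw [HalfEdgeGraph.shadowMatrix_eq_map, ← RingHom.mapMatrix_apply, ← RingHom.map_det]
  by_cases hv : ∀ v, P.shadowInc (D.initial v) =
      P.shadowInc ((P.touchGraph hF).opp (D.initial v))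
  · rcases Int.isUnit_iff.mp (HalfEdgeGraph.isUnit_det_shadowMatrix D hΓ hv) with h | h <;>
      simp [h]
  · obtain ⟨v, hv⟩ := not_forall.mp hv
    simp [HalfEdgeGraph.det_shadowMatrix_eq_zero D Γ hv]
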